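/- Fix Nakagami shape parameters $m_1,m_2>0$ and a mean square $\Omega>0$. For $j\in\{1,2\}$ let the fading power $N_j^2$ have density $$f_{N_j^2}(x)=\frac{m_j^{m_j}x^{m_j-1}}{\Omega^{m_j}\Gamma(m_j)}e^{-m_jx/\Omega},\qquad x>0 .$$ The inverse-gamma law with shape $\alpha>1$ and scale $g>0$ has density $\frac{g^{\alpha}}{\Gamma(\alpha)y^{\alpha+1}}e^{-g/y}$, $y>0$. The outage probability of an SNR $X$ at threshold $\gamma$ is $\Pr\{X\le\gamma\}=F_X(\gamma)$, the value at $\gamma$ of its CDF. For $z>0$, $G^{m,n}_{p,q}(z\,|\,a_1,\dots,a_p;b_1,\dots,b_q)$ is Meijer's function $$\frac1{2\pi i}\int_{\sigma-i\infty}^{\sigma+i\infty}\frac{\prod_{j=1}^m\Gamma(b_j-s)\prod_{j=1}^n\Gamma(1-a_j+s)}{\prod_{j=m+1}^q\Gamma(1-b_j+s)\prod_{j=n+1}^p\Gamma(a_j-s)}\,z^s\,ds ,$$ the line $\operatorname{Re}s=\sigma$ having the poles of $\Gamma(b_j-s)$, $j\le m$, on its right and those of $\Gamma(1-a_j+s)$,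 $j\le n$, on its left. (Double shadowing.) Let $I_1,I_2$ have inverse-gamma laws with shapes $\alpha_1,\alpha_2>1$ and scales $\bar\gamma_1,\bar\gamma_2>0$. Assume that $N_j^2$ and $I_j$ are independent for $j=1,2$ and that $M_1=N_1^2I_1$ and $M_2=N_2^2I_2$ are independent (for instance, that $N_1,N_2,I_1,I_2$ are independent). Then for every $\gamma>0$ the CDF, i.e. the outage probability, of the SNR $M_1M_2$ is $$F(\gamma)=\frac{1}{\Gamma(m_1)\Gamma(m_2)\Gamma(\alpha_1)\Gamma(\alpha_2)}\,G^{2,3}_{3,3}\bigl(\tilde\gamma\gamma\,\big|\,1-\alpha_2,1-\alpha_1,1;\,m_1,m_2,0\bigr),\qquad \tilde\gamma=\frac{m_1m_2}{\bar\gamma},\quad \bar\gamma=\Omega^2\bar\gamma_1\bar\gamma_2 .$$ (Single shadowing.) Let $I$ have the inverse-gamma law with shape $\alpha>1$ and scale $g>0$. Assume that $N_1^2$ and $N_2^2$ are independent and that $(N_1N_2)^2$ and $I$ are independent. Then for every $\gamma>0$ the CDF, i.e. the outage probability, of the SNR $(N_1N_2)^2I$ is $$F(\gamma)=\frac{1}{\Gamma(m_1)\Gamma(m_2)\Gamma(\alpha)}\,G^{2,2}_{2,3}\bigl(\tilde\gamma\gamma\,\big|\,1-\alpha,1;\,m_1,m_2,0\bigr),\qquad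 \tilde\gamma=\frac{m_1m_2}{\bar\gamma},\quad \bar\gamma=\Omega^2g .$$ In both cases separating lines exist, the integral converges absolutely on each of them, and its value does not depend on the line. -/

import Mathlib

namespace ShadowedScattering

open MeasureTheory ProbabilityTheory

/-- The density of the squared Nakagami-`m` envelope with shape `m` and mean square `Ω`:
`m ^ m * x ^ (m - 1) / (Ω ^ m * Γ(m)) * exp (-m x / Ω)` on `x > 0`, and `0` elsewhere. -/
noncomputable def nakagamiSqPDFReal (m Ω x : ℝ) : ℝ :=
  if 0 < x then
    m ^ m * x ^ (m - 1) / (Ω ^ m * Real.Gamma m) * Real.exp (-(m * x / Ω))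
  else 0

/-- The law on `ℝ` of the squared Nakagami-`m` envelope. -/
noncomputable def nakagamiSqMeasure (m Ω : ℝ) : Measure ℝ :=
  volume.withDensity fun x => ENNReal.ofReal (nakagamiSqPDFReal m Ω x)

/-- The law of the squared Nakagami-`m` envelope is the gamma law of shape `m`, rate `m / Ω`. -/
theorem nakagamiSqMeasure_eq_gammaMeasure {m Ω : ℝ} (hm : 0 < m) (hΩ : 0 < Ω) :
    nakagamiSqMeasure m Ω = gammaMeasure m (m / Ω) := by
  unfold nakagamiSqMeasure gammaMeasure
  refine withDensity_congr_ae ?_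
  have h0 : ∀ᵐ x : ℝ, x ≠ 0 := by simp [ae_iff]
  filter_upwards [h0] with x hx
  unfold gammaPDF nakagamiSqPDFReal gammaPDFReal
  congr 1
  rcases lt_or_gt_of_ne hx with h | h
  · rw [if_neg (not_lt.mpr h.le), if_neg (not_le.mpr h)]
  · rw [if_pos h, if_pos h.le, Real.div_rpow hm.le hΩ.le,
      show m / Ω * x = m * x / Ω by ring]
    have h1 : Ω ^ m ≠ 0 := (Real.rpow_pos_of_pos hΩ m).ne'
    have h2 : Real.Gamma m ≠ 0 := (Real.Gamma_pos_of_pos hm).ne'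
    field_simp

/-- The inverse-gamma density with shape `α` and scale `g`:
`g ^ α / (Γ(α) * y ^ (α + 1)) * exp (-g / y)` on `y > 0`, and `0` elsewhere. -/
noncomputable def invGammaPDFReal (α g y : ℝ) : ℝ :=
  if 0 < y then
    g ^ α / (Real.Gamma α * y ^ (α + 1)) * Real.exp (-(g / y))
  else 0

/-- The inverse-gamma law on `ℝ` with shape `α` and scale `g`. -/
noncomputable def invGammaMeasure (α g : ℝ) : Measure ℝ :=
  volume.withDensity fun y => ENNReal.ofReal (invGammaPDFReal α g y)

/-- The outage probability at the threshold `γT` of a random SNR `X`. -/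
noncomputable def outageProbability {S : Type*} [MeasurableSpace S] (P : Measure S)
    (X : S → ℝ) (γT : ℝ) : ℝ :=
  P.real {ω | X ω ≤ γT}

/-- The Mellin-Barnes integrand of the Meijer function `G^{m,n}_{p,q}(z | a; b)`,
`∏_{j ≤ m} Γ(b_j - s) ∏_{j ≤ n} Γ(1 - a_j + s) z ^ s /
  (∏_{j > m} Γ(1 - b_j + s) ∏_{j > n} Γ(a_j - s))`
(here the indices `j` start from `0`; `Complex.Gamma` vanishes at its poles, so that the
inverses below are the values of the entire function `1 / Γ` everywhere). -/
noncomputable def meijerIntegrand (m n : ℕ) {p q : ℕ} (a : Fin p → ℂ) (b : Fin q → ℂ)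
    (z s : ℂ) : ℂ :=
  (∏ j : Fin q, if j.val < m then Complex.Gamma (b j - s) else (Complex.Gamma (1 - b j + s))⁻¹) *
  (∏ j : Fin p, if j.val < n then Complex.Gamma (1 - a j + s) else (Complex.Gamma (a j - s))⁻¹) *
  z ^ s

/-- The vertical line `Re s = σ` separates the poles of `Γ(b_j - s)`, `j ≤ m`, which lie on
its right, from those of `Γ(1 - a_j + s)`, `j ≤ n`, which lie on its left. -/
def MeijerSeparates (m n : ℕ) {p q : ℕ} (a : Fin p → ℂ) (b : Fin q → ℂ) (σ : ℝ) : Prop :=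
  (∀ j : Fin q, j.val < m → σ < (b j).re) ∧ (∀ j : Fin p, j.val < n → (a j).re - 1 < σ)

/-- `(2 π i)⁻¹ ∫ f(s) ds` along the line `Re s = σ` from `σ - i ∞` to `σ + i ∞`, where `f` is
the Mellin-Barnes integrand (`s = σ + i t`, `ds = i dt`). -/
noncomputable def meijerLineIntegral (m n : ℕ) {p q : ℕ} (a : Fin p → ℂ) (b : Fin q → ℂ)
    (z : ℂ) (σ : ℝ) : ℂ :=
  (2 * (Real.pi : ℂ))⁻¹ * ∫ t : ℝ, meijerIntegrand m n a b z (σ + t * Complex.I)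

open Classical in
/-- The Meijer function `G^{m,n}_{p,q}(z | a; b)`: the Mellin-Barnes integral along a vertical
line that separates the two families of poles (`0` by convention if there is no such line). -/
noncomputable def meijerG (m n : ℕ) {p q : ℕ} (a : Fin p → ℂ) (b : Fin q → ℂ) (z : ℂ) : ℂ :=
  if h : ∃ σ : ℝ, MeijerSeparates m n a b σ then meijerLineIntegral m n a b z h.choose else 0

/-- The value `meijerG m n a b z` is a genuine one: there is a separating line, the integral
converges absolutely on every such line, and its value does not depend on the line. -/
def MeijerGWellDefined (m n : ℕ) {p q : ℕ} (a : Fin p → ℂ) (b : Fin q → ℂ) (z : ℂ) : Prop :=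
  (∃ σ : ℝ, MeijerSeparates m n a b σ) ∧
  ∀ σ : ℝ, MeijerSeparates m n a b σ →
    Integrable (fun t : ℝ => meijerIntegrand m n a b z (σ + t * Complex.I)) ∧
    meijerLineIntegral m n a b z σ = meijerG m n a b z

end ShadowedScattering

namespace ShadowedScattering

section

open MeasureTheory ProbabilityTheory Measure Set Filter Topology

/-! For a positive law `μ` with CDF `F`, write `M(s)` for the moment of order `-s`. If `Re s > 0`
and this moment exists, the Mellin transform of `x ↦ F(1/x)` at `s` is `M(s)/s`
(`hasMellin_cdf_inv`). Mellin inversion then gives `F(γ) = (2πi)⁻¹ ∫ γ^s M(s)/s ds` wherever `F` is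
continuous (`cdf_eq_integral_negMoment`).

Moments multiply over independent factors. A fading power contributes `(m/Ω)^s Γ(m-s)/Γ(m)`, a
shadowing factor `g^(-s) Γ(α+s)/Γ(α)`. Writing `1/s = Γ(s)/Γ(1+s)` turns `γ^s M(s)/s` into a
constant times the Meijer integrand.

On a separating line every Gamma factor is bounded. One factor `Γ(α+s)` decays like `1/|s|`, which
together with `1/s` gives absolute convergence. No contour is shifted: each separating line yields
the same number `F(γ)`, so the integral cannot depend on the line (`meijerG_of_hasNegMoment`). -/

/-! ### Positive atomless laws and their negative moments under products. -/

/-- A measure on `ℝ` that is carried by the positive reals and has no atoms. -/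
structure PosDiffuse (μ : Measure ℝ) : Prop where
  ae_pos : ∀ᵐ x ∂μ, 0 < x
  measure_singleton : ∀ c : ℝ, μ {c} = 0

/-- The moment of order `-s` of the law `μ` exists and equals `v`. -/
def HasNegMoment (μ : Measure ℝ) (s v : ℂ) : Prop :=
  Integrable (fun x : ℝ => (x : ℂ) ^ (-s)) μ ∧ ∫ x : ℝ, (x : ℂ) ^ (-s) ∂μ = v

theorem posDiffuse_withDensity {f : ℝ → ENNReal} (hf : Measurable f) (h0 : ∀ x, x ≤ 0 → f x = 0) :
    PosDiffuse (volume.withDensity f) where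
  ae_pos := by
    rw [ae_withDensity_iff hf]
    refine ae_of_all _ fun x hx => ?_
    by_contra h
    exact hx (h0 x (not_lt.1 h))
  measure_singleton c := withDensity_absolutelyContinuous _ _ (by simp)

/-- For fixed `x > 0` only `y = c / x` solves `x * y = c`, so every fibre of the preimage of `{c}`
is null. -/
theorem PosDiffuse.mconv {μ ν : Measure ℝ} [SFinite μ] [SFinite ν] (hμ : PosDiffuse μ)
    (hν : PosDiffuse ν) : PosDiffuse (μ ∗ₘ ν) where
  ae_pos := by
    unfold Measure.mconv
    rw [ae_map_iff (by fun_prop) measurableSet_Ioi]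
    filter_upwards [quasiMeasurePreserving_fst.ae hμ.ae_pos,
      quasiMeasurePreserving_snd.ae hν.ae_pos] with z h1 h2
    exact mul_pos h1 h2
  measure_singleton c := by
    have hm : Measurable fun z : ℝ × ℝ => z.1 * z.2 := by fun_prop
    unfold Measure.mconv
    rw [map_apply hm (measurableSet_singleton c),
      measure_prod_null (hm (measurableSet_singleton c))]
    filter_upwards [hμ.ae_pos] with x hx
    refine measure_mono_null (fun y hy => ?_) (hν.measure_singleton (c / x))
    have : x * y = c := hy
    simp [← this, hx.ne']

/-- Positivity makes the complex power multiplicative almost everywhere; Fubini then splits the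
integral. -/
theorem HasNegMoment.mconv {μ ν : Measure ℝ} [SFinite μ] [SFinite ν] (hμ : PosDiffuse μ)
    (hν : PosDiffuse ν) {s v w : ℂ} (hv : HasNegMoment μ s v) (hw : HasNegMoment ν s w) :
    HasNegMoment (μ ∗ₘ ν) s (v * w) := by
  have hm : Measurable fun z : ℝ × ℝ => z.1 * z.2 := by fun_prop
  have hc : Measurable fun x : ℝ => (x : ℂ) ^ (-s) := by fun_prop
  have he : (fun z : ℝ × ℝ => (z.1 : ℂ) ^ (-s) * (z.2 : ℂ) ^ (-s)) =ᵐ[μ.prod ν]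
      fun z : ℝ × ℝ => ((z.1 * z.2 : ℝ) : ℂ) ^ (-s) := by
    filter_upwards [quasiMeasurePreserving_fst.ae hμ.ae_pos,
      quasiMeasurePreserving_snd.ae hν.ae_pos] with z h1 h2
    rw [Complex.ofReal_mul, Complex.mul_cpow_ofReal_nonneg h1.le h2.le]
  unfold Measure.mconv HasNegMoment
  rw [integrable_map_measure hc.aestronglyMeasurable hm.aemeasurable,
    integral_map hm.aemeasurable hc.aestronglyMeasurable]
  refine ⟨(hv.1.mul_prod hw.1).congr he, ?_⟩
  rw [← integral_congr_ae he, integral_prod_mul (fun x : ℝ => (x : ℂ) ^ (-s))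
    (fun x : ℝ => (x : ℂ) ^ (-s)), hv.2, hw.2]

theorem continuousAt_cdf {μ : Measure ℝ} [IsProbabilityMeasure μ] {a : ℝ} (h : μ {a} = 0) :
    ContinuousAt (cdf μ) a := by
  rw [(monotone_cdf μ).continuousAt_iff_leftLim_eq_rightLim, StieltjesFunction.rightLim_eq]
  rw [← measure_cdf μ, StieltjesFunction.measure_singleton, ENNReal.ofReal_eq_zero] at h
  exact le_antisymm ((monotone_cdf μ).leftLim_le le_rfl) (by linarith)

theorem hasNegMoment_of_withDensity {f : ℝ → ℝ} (hf : Measurable f) (hf0 : ∀ x, 0 ≤ f x)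
    (h0 : ∀ x, x ≤ 0 → f x = 0) {s v : ℂ} (hv : v ≠ 0)
    (h : ∫ x in Ioi (0 : ℝ), (f x : ℂ) * (x : ℂ) ^ (-s) = v) :
    HasNegMoment (volume.withDensity fun x => ENNReal.ofReal (f x)) s v := by
  have : ∫ x : ℝ, (x : ℂ) ^ (-s) ∂(volume.withDensity fun x => ENNReal.ofReal (f x)) = v := by
    rw [integral_withDensity_eq_integral_toReal_smul (by fun_prop) (by simp), ← h,
      ← integral_indicator measurableSet_Ioi]
    refine integral_congr_ae (ae_of_all _ fun x => ?_)
    by_cases hx : 0 < x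
    · simp [hx, ENNReal.toReal_ofReal (hf0 x)]
    · simp [hx, h0 x (not_lt.1 hx)]
  -- The Bochner integral of a non-integrable function is `0`, so a nonzero value already proves
  -- integrability.
  exact ⟨Integrable.of_integral_ne_zero (this ▸ hv), this⟩

/-! ### Negative moments of the fading and shadowing laws. -/

theorem measurable_nakagamiSqPDFReal (m Ω : ℝ) : Measurable (nakagamiSqPDFReal m Ω) :=
  Measurable.ite measurableSet_Ioi (by fun_prop) measurable_const

theorem measurable_invGammaPDFReal (α g : ℝ) : Measurable (invGammaPDFReal α g) :=
  Measurable.ite measurableSet_Ioi (by fun_prop) measurable_const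

theorem posDiffuse_nakagamiSqMeasure (m Ω : ℝ) : PosDiffuse (nakagamiSqMeasure m Ω) :=
  posDiffuse_withDensity (measurable_nakagamiSqPDFReal m Ω).ennreal_ofReal fun x hx => by
    simp [nakagamiSqPDFReal, not_lt.2 hx]

theorem posDiffuse_invGammaMeasure (α g : ℝ) : PosDiffuse (invGammaMeasure α g) :=
  posDiffuse_withDensity (measurable_invGammaPDFReal α g).ennreal_ofReal fun x hx => by
    simp [invGammaPDFReal, not_lt.2 hx]

theorem hasNegMoment_nakagamiSqMeasure {m Ω : ℝ} (hm : 0 < m) (hΩ : 0 < Ω) {s : ℂ}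
    (hs : s.re < m) :
    HasNegMoment (nakagamiSqMeasure m Ω) s
      (((m / Ω : ℝ) : ℂ) ^ s * (Complex.Gamma (m - s) / Real.Gamma m)) := by
  have hr : 0 < m / Ω := div_pos hm hΩ
  have hrc : ((m / Ω : ℝ) : ℂ) ≠ 0 := by exact_mod_cast hr.ne'
  have hΓ : (Real.Gamma m : ℂ) ≠ 0 := by exact_mod_cast (Real.Gamma_pos_of_pos hm).ne'
  have hms : 0 < (m - s : ℂ).re := by simpa using hs
  refine hasNegMoment_of_withDensity (measurable_nakagamiSqPDFReal m Ω) (fun x => ?_)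
    (fun x hx => by simp [nakagamiSqPDFReal, not_lt.2 hx]) ?_ ?_
  · unfold nakagamiSqPDFReal
    have := Real.Gamma_pos_of_pos hm
    split_ifs <;> positivity
  · exact mul_ne_zero (by simp [Complex.cpow_eq_zero_iff, hm.ne', hΩ.ne'])
      (div_ne_zero (Complex.Gamma_ne_zero_of_re_pos hms) hΓ)
  · have key : ∀ x ∈ Ioi (0 : ℝ), (nakagamiSqPDFReal m Ω x : ℂ) * (x : ℂ) ^ (-s) =
        ((m / Ω : ℝ) : ℂ) ^ (m : ℂ) / Real.Gamma m *
          ((x : ℂ) ^ ((m - s : ℂ) - 1) * Complex.exp (-((m / Ω : ℝ) * x))) := by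
      intro x hx
      have hx' : (0 : ℝ) < x := hx
      have hxc : (x : ℂ) ≠ 0 := by exact_mod_cast hx'.ne'
      rw [show (m - s - 1 : ℂ) = ((m - 1 : ℝ) : ℂ) + -s by push_cast; ring,
        Complex.cpow_add _ _ hxc, ← Complex.ofReal_cpow hx'.le, ← Complex.ofReal_cpow hr.le,
        nakagamiSqPDFReal, if_pos hx', Real.div_rpow hm.le hΩ.le, mul_div_right_comm]
      push_cast
      field_simp
    rw [setIntegral_congr_fun measurableSet_Ioi key, integral_const_mul,
      Complex.integral_cpow_mul_exp_neg_mul_Ioi hms hr, one_div,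
      Complex.inv_cpow _ _ (by rw [Complex.arg_ofReal_of_nonneg hr.le]; exact Real.pi_pos.ne),
      Complex.cpow_sub _ _ hrc]
    have h1 : ((m / Ω : ℝ) : ℂ) ^ (m : ℂ) ≠ 0 := by simp [Complex.cpow_eq_zero_iff, hm.ne', hΩ.ne']
    have h2 : ((m / Ω : ℝ) : ℂ) ^ s ≠ 0 := by simp [Complex.cpow_eq_zero_iff, hm.ne', hΩ.ne']
    field_simp

theorem hasNegMoment_invGammaMeasure {α g : ℝ} (hα : 0 < α) (hg : 0 < g) {s : ℂ}
    (hs : -α < s.re) :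
    HasNegMoment (invGammaMeasure α g) s
      ((g : ℂ) ^ (-s) * (Complex.Gamma (α + s) / Real.Gamma α)) := by
  have hgc : (g : ℂ) ≠ 0 := by exact_mod_cast hg.ne'
  have hΓ : (Real.Gamma α : ℂ) ≠ 0 := by exact_mod_cast (Real.Gamma_pos_of_pos hα).ne'
  have hαs : 0 < (α + s : ℂ).re := by simpa using by linarith
  refine hasNegMoment_of_withDensity (measurable_invGammaPDFReal α g) (fun x => ?_)
    (fun x hx => by simp [invGammaPDFReal, not_lt.2 hx]) ?_ ?_
  · unfold invGammaPDFReal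
    have := Real.Gamma_pos_of_pos hα
    split_ifs <;> positivity
  · exact mul_ne_zero (by simp [Complex.cpow_eq_zero_iff, hg.ne'])
      (div_ne_zero (Complex.Gamma_ne_zero_of_re_pos hαs) hΓ)
  · have key : ∀ x ∈ Ioi (0 : ℝ), (invGammaPDFReal α g x : ℂ) * (x : ℂ) ^ (-s) =
        (g : ℂ) ^ (α : ℂ) / Real.Gamma α *
          ((x : ℂ) ^ (-(α + s : ℂ) - 1) • Complex.exp (-(g * (x⁻¹ : ℝ)))) := by
      intro x hx
      have hx' : (0 : ℝ) < x := hx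
      have hxc : (x : ℂ) ≠ 0 := by exact_mod_cast hx'.ne'
      have h1 : ((x ^ (α + 1) : ℝ) : ℂ) ≠ 0 := by exact_mod_cast (Real.rpow_pos_of_pos hx' _).ne'
      rw [show (-(α + s : ℂ) - 1 : ℂ) = -((α + 1 : ℝ) : ℂ) + -s by push_cast; ring,
        Complex.cpow_add _ _ hxc, Complex.cpow_neg _ ((α + 1 : ℝ) : ℂ), ← Complex.ofReal_cpow hx'.le,
        ← Complex.ofReal_cpow hg.le, invGammaPDFReal, if_pos hx', smul_eq_mul, div_eq_mul_inv g x]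
      push_cast
      field_simp
    -- The substitution `x ↦ 1/x` turns this into Euler's integral for `Γ(α + s)`.
    have hmel : ∫ x in Ioi (0 : ℝ), (x : ℂ) ^ (-(α + s : ℂ) - 1) •
        Complex.exp (-(g * (x⁻¹ : ℝ))) = (1 / g : ℂ) ^ (α + s : ℂ) * Complex.Gamma (α + s) := by
      have := mellin_comp_inv (fun t : ℝ => Complex.exp (-(g * t))) (-(α + s : ℂ))
      rw [neg_neg] at this
      rw [← Complex.integral_cpow_mul_exp_neg_mul_Ioi hαs hg]
      exact this
    rw [setIntegral_congr_fun measurableSet_Ioi key, integral_const_mul, hmel, one_div,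
      Complex.inv_cpow _ _ (by rw [Complex.arg_ofReal_of_nonneg hg.le]; exact Real.pi_pos.ne),
      Complex.cpow_add _ _ hgc, Complex.cpow_neg]
    have h1 : (g : ℂ) ^ (α : ℂ) ≠ 0 := by simp [Complex.cpow_eq_zero_iff, hg.ne']
    have h2 : (g : ℂ) ^ s ≠ 0 := by simp [Complex.cpow_eq_zero_iff, hg.ne']
    field_simp

/-! ### Gamma bounds and integrability on vertical lines. -/

theorem norm_Gamma_le_Gamma_re {s : ℂ} (hs : 0 < s.re) :
    ‖Complex.Gamma s‖ ≤ Real.Gamma s.re := by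
  rw [Complex.Gamma_eq_integral hs, Real.Gamma_eq_integral hs, Complex.GammaIntegral]
  refine (norm_integral_le_integral_norm _).trans_eq ?_
  refine setIntegral_congr_fun measurableSet_Ioi fun x hx => ?_
  have hx' : (0 : ℝ) < x := hx
  simp only [norm_mul, Complex.norm_cpow_eq_rpow_re_of_pos hx', Complex.norm_real,
    Real.norm_eq_abs, Real.abs_exp, Complex.sub_re, Complex.one_re]

/-- One use of `Γ(s+1) = s Γ(s)` trades boundedness for decay of order `1/|s|`. -/
theorem norm_Gamma_le_div {s : ℂ} (hs : 0 < s.re) :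
    ‖Complex.Gamma s‖ ≤ Real.Gamma (s.re + 1) / ‖s‖ := by
  have h0 : s ≠ 0 := fun h => by simp [h] at hs
  rw [le_div_iff₀ (norm_pos_iff.2 h0), mul_comm, ← norm_mul, ← Complex.Gamma_add_one s h0]
  have := norm_Gamma_le_Gamma_re (s := s + 1) (by simpa using by linarith)
  simpa using this

theorem continuous_Gamma_comp {f : ℝ → ℂ} (hf : Continuous f) (h : ∀ t, 0 < (f t).re) :
    Continuous fun t => Complex.Gamma (f t) := by
  rw [continuous_iff_continuousAt]
  intro t
  refine ContinuousAt.comp (g := Complex.Gamma) ?_ hf.continuousAt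
  refine (Complex.differentiableAt_Gamma _ fun m hm => ?_).continuousAt
  have := h t
  rw [hm] at this
  simp at this
  linarith [(Nat.cast_nonneg m : (0 : ℝ) ≤ m)]

theorem integrable_inv_sq_add_sq {σ : ℝ} (hσ : 0 < σ) :
    Integrable fun t : ℝ => (σ ^ 2 + t ^ 2)⁻¹ := by
  have := (integrable_inv_one_add_sq.comp_div hσ.ne').const_mul (σ ^ 2)⁻¹
  refine this.congr (ae_of_all _ fun t => ?_)
  simp only
  rw [← mul_inv]
  congr 1
  field_simp

/-- The source of absolute convergence: `|Γ(α+s)|` is at most a constant over `|α+s|`, and `|α+s| ≥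
|s|`, so the product is dominated by a multiple of `1/|s|²`. -/
theorem integrable_Gamma_mul_inv {α σ : ℝ} (hα : 0 < α) (hσ : 0 < σ) :
    Integrable fun t : ℝ =>
      Complex.Gamma (α + (σ + t * Complex.I)) * (σ + t * Complex.I : ℂ)⁻¹ := by
  refine ((integrable_inv_sq_add_sq hσ).const_mul (Real.Gamma (α + σ + 1))).mono' ?_ ?_
  · refine (Continuous.mul (continuous_Gamma_comp (by fun_prop) fun t => ?_)
      (Continuous.inv₀ (by fun_prop) fun t h => ?_)).aestronglyMeasurable
    · simpa using by linarith
    · have := congrArg Complex.re h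
      simp at this
      linarith
  · refine ae_of_all _ fun t => ?_
    have h1 : 0 < (α + (σ + t * Complex.I) : ℂ).re := by simpa using by linarith
    have hΓ : 0 < Real.Gamma (α + σ + 1) := Real.Gamma_pos_of_pos (by linarith)
    have h2 := norm_Gamma_le_div h1
    have hre : (α + (σ + t * Complex.I) : ℂ).re = α + σ := by simp
    have hs : ‖(σ + t * Complex.I : ℂ)‖ ^ 2 = σ ^ 2 + t ^ 2 := by
      rw [Complex.sq_norm, Complex.normSq_add_mul_I]
    have hs' : ‖(α + (σ + t * Complex.I) : ℂ)‖ ^ 2 = (α + σ) ^ 2 + t ^ 2 := by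
      rw [Complex.sq_norm, ← add_assoc, ← Complex.ofReal_add, Complex.normSq_add_mul_I]
    have hpos : 0 < ‖(σ + t * Complex.I : ℂ)‖ := by
      refine norm_pos_iff.2 fun h => ?_
      have := congrArg Complex.re h
      simp at this
      linarith
    have hle : ‖(σ + t * Complex.I : ℂ)‖ ≤ ‖(α + (σ + t * Complex.I) : ℂ)‖ := by
      refine (sq_le_sq₀ (norm_nonneg _) (norm_nonneg _)).1 ?_
      rw [hs, hs']
      nlinarith [mul_pos hα hσ]
    rw [hre] at h2
    rw [norm_mul, norm_inv, ← hs, sq, mul_inv, ← mul_assoc]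
    gcongr
    exact h2.trans (by rw [div_eq_mul_inv]; gcongr)

theorem integrable_Gamma_mul {f g : ℝ → ℂ} (hf : Continuous f) {c : ℝ} (hc : 0 < c)
    (h : ∀ t, (f t).re = c) (hg : Integrable g) :
    Integrable fun t => Complex.Gamma (f t) * g t := by
  refine hg.bdd_mul (c := Real.Gamma c)
    (continuous_Gamma_comp hf fun t => (h t).symm ▸ hc).aestronglyMeasurable
    (ae_of_all _ fun t => ?_)
  have := norm_Gamma_le_Gamma_re (s := f t) ((h t).symm ▸ hc)
  rwa [h t] at this

theorem integrable_cpow_mul {z σ : ℝ} (hz : 0 < z) {g : ℝ → ℂ} (hg : Integrable g) :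
    Integrable fun t : ℝ => (z : ℂ) ^ (σ + t * Complex.I : ℂ) * g t := by
  refine hg.bdd_mul (c := z ^ σ) (Continuous.aestronglyMeasurable ?_) (ae_of_all _ fun t => ?_)
  · exact Continuous.const_cpow (by fun_prop) (Or.inl (by exact_mod_cast hz.ne'))
  · rw [Complex.norm_cpow_eq_rpow_re_of_pos hz]
    simp

/-! ### Mellin transform of the CDF and its inversion. -/

/-- Since `y ≤ 1/x` means `x ≤ 1/y`, the integral is that of `x^(s-1)` over `(0, 1/y]`. Integrating
the same kernel over `y` instead produces the CDF at `1/x`. -/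
theorem integral_cpow_mul_indicator {s : ℂ} (hs : 0 < s.re) {y : ℝ} (hy : 0 < y) :
    Integrable (fun x : ℝ => (x : ℂ) ^ (s - 1) * (Iic x⁻¹).indicator 1 y)
      (volume.restrict (Ioi 0)) ∧
    ∫ x in Ioi (0 : ℝ), (x : ℂ) ^ (s - 1) * (Iic x⁻¹).indicator 1 y = (y : ℂ) ^ (-s) / s := by
  have hre : -1 < (s - 1).re := by simpa using hs
  have hs0 : s ≠ 0 := fun h => by simp [h] at hs
  have key : EqOn (fun x : ℝ => (x : ℂ) ^ (s - 1) * (Iic x⁻¹).indicator (1 : ℝ → ℂ) y)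
      ((Iic y⁻¹).indicator fun x : ℝ => (x : ℂ) ^ (s - 1)) (Ioi 0) := by
    intro x hx
    have hx' : (0 : ℝ) < x := hx
    have : y ≤ x⁻¹ ↔ x ≤ y⁻¹ := le_inv_comm₀ hy hx'
    by_cases h : x ≤ y⁻¹ <;> simp [indicator, this, h]
  have hset : Ioi (0 : ℝ) ∩ Iic y⁻¹ = Ioc 0 y⁻¹ := rfl
  have hint := (intervalIntegral.intervalIntegrable_cpow' (a := 0) (b := y⁻¹) hre).1
  constructor
  · change IntegrableOn _ _ volume
    rw [integrableOn_congr_fun key measurableSet_Ioi]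
    unfold IntegrableOn
    rw [integrable_indicator_iff measurableSet_Iic, IntegrableOn,
      restrict_restrict measurableSet_Iic, inter_comm, hset]
    exact hint
  · rw [setIntegral_congr_fun measurableSet_Ioi key, setIntegral_indicator measurableSet_Iic, hset,
      ← intervalIntegral.integral_of_le (by positivity), integral_cpow (Or.inl hre), sub_add_cancel,
      Complex.ofReal_zero, Complex.zero_cpow hs0, sub_zero, Complex.ofReal_inv,
      Complex.inv_cpow _ _ (by rw [Complex.arg_ofReal_of_nonneg hy.le]; exact Real.pi_pos.ne),
      Complex.cpow_neg]

theorem integrable_prod_cpow_mul_indicator {μ : Measure ℝ} [IsProbabilityMeasure μ]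
    (hμ : ∀ᵐ x ∂μ, 0 < x) {s : ℂ} (hs : 0 < s.re)
    (hi : Integrable (fun x : ℝ => (x : ℂ) ^ (-s)) μ) :
    Integrable (Function.uncurry fun x y : ℝ => (x : ℂ) ^ (s - 1) * (Iic x⁻¹).indicator 1 y)
      ((volume.restrict (Ioi 0)).prod μ) := by
  have hmeas : Measurable (Function.uncurry fun x y : ℝ =>
      (x : ℂ) ^ (s - 1) * (Iic x⁻¹).indicator (1 : ℝ → ℂ) y) := by
    have hset : MeasurableSet {z : ℝ × ℝ | z.2 ≤ z.1⁻¹} :=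
      measurableSet_le measurable_snd measurable_fst.inv
    have h1 : Measurable fun z : ℝ × ℝ => (z.1 : ℂ) ^ (s - 1) := by fun_prop
    exact h1.mul (measurable_one.indicator hset)
  rw [integrable_prod_iff' hmeas.aestronglyMeasurable]
  refine ⟨?_, ?_⟩
  · filter_upwards [hμ] with y hy
    exact (integral_cpow_mul_indicator hs hy).1
  · refine (hi.norm.div_const s.re).congr ?_
    filter_upwards [hμ] with y hy
    -- The norm of the kernel is the kernel with real exponent `Re s`, so its integral in `x` is
    -- `y^(-Re s) / Re s`.
    have h := (integral_cpow_mul_indicator (s := (s.re : ℂ)) (by simpa using hs) hy).2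
    rw [Complex.norm_cpow_eq_rpow_re_of_pos hy, Complex.neg_re]
    rw [← Complex.ofReal_neg, ← Complex.ofReal_cpow hy.le, ← Complex.ofReal_div] at h
    rw [← Complex.ofReal_inj, ← h, ← integral_complex_ofReal]
    refine setIntegral_congr_fun measurableSet_Ioi fun x hx => ?_
    have hx' : (0 : ℝ) < x := hx
    have : ((s.re : ℂ) - 1) = ((s.re - 1 : ℝ) : ℂ) := by push_cast; rfl
    simp only [Function.uncurry, norm_mul, Complex.norm_cpow_eq_rpow_re_of_pos hx', this,
      Complex.ofReal_mul, ← Complex.ofReal_cpow hx'.le, Complex.sub_re, Complex.one_re]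
    congr 1
    by_cases h : y ∈ Iic x⁻¹ <;> simp [indicator, h]

theorem hasMellin_cdf_inv {μ : Measure ℝ} [IsProbabilityMeasure μ] (hμ : ∀ᵐ x ∂μ, 0 < x)
    {s v : ℂ} (hs : 0 < s.re) (hv : HasNegMoment μ s v) :
    HasMellin (fun x : ℝ => ((cdf μ x⁻¹ : ℝ) : ℂ)) s (v / s) := by
  have hi := integrable_prod_cpow_mul_indicator hμ hs hv.1
  have hin : ∀ x : ℝ, ∫ y, (x : ℂ) ^ (s - 1) * (Iic x⁻¹).indicator (1 : ℝ → ℂ) y ∂μ =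
      (x : ℂ) ^ (s - 1) • ((cdf μ x⁻¹ : ℝ) : ℂ) := by
    intro x
    rw [integral_const_mul, integral_indicator measurableSet_Iic, cdf_eq_real, smul_eq_mul]
    simp
  refine ⟨?_, ?_⟩
  · have := hi.integral_prod_left
    simp only [Function.uncurry, hin] at this
    exact this
  · have := integral_integral_swap hi
    simp only [hin] at this
    rw [mellin, this]
    rw [integral_congr_ae (g := fun y : ℝ => (y : ℂ) ^ (-s) / s), integral_div, hv.2]
    filter_upwards [hμ] with y hy
    exact (integral_cpow_mul_indicator hs hy).2

/-- Mellin inversion for the cumulative distribution function of a positive law. -/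
theorem cdf_eq_integral_negMoment {μ : Measure ℝ} [IsProbabilityMeasure μ] (hμ : PosDiffuse μ)
    {σ : ℝ} (hσ : 0 < σ) {M : ℂ → ℂ} (hM : ∀ s : ℂ, s.re = σ → HasNegMoment μ s (M s))
    (hint : Integrable fun t : ℝ => M (σ + t * Complex.I) / (σ + t * Complex.I))
    {γ : ℝ} (hγ : 0 < γ) :
    ((cdf μ γ : ℝ) : ℂ) = (2 * (Real.pi : ℂ))⁻¹ *
      ∫ t : ℝ, (γ : ℂ) ^ (σ + t * Complex.I : ℂ) *
        (M (σ + t * Complex.I) / (σ + t * Complex.I)) := by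
  have hmel : ∀ t : ℝ, HasMellin (fun x : ℝ => ((cdf μ x⁻¹ : ℝ) : ℂ)) (σ + t * Complex.I)
      (M (σ + t * Complex.I) / (σ + t * Complex.I)) := fun t =>
    hasMellin_cdf_inv hμ.ae_pos (by simpa using hσ) (hM _ (by simp))
  -- Inversion of `x ↦ F(1/x)` is used at the point `γ⁻¹`; absence of an atom at `γ` gives the
  -- continuity it needs.
  have hcont : ContinuousAt (fun x : ℝ => ((cdf μ x⁻¹ : ℝ) : ℂ)) γ⁻¹ := by
    refine Complex.continuous_ofReal.continuousAt.comp (ContinuousAt.comp (g := cdf μ) ?_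
      (continuousAt_inv₀ (inv_ne_zero hγ.ne')))
    rw [inv_inv]
    exact continuousAt_cdf (hμ.measure_singleton γ)
  have h := mellinInv_mellin_eq σ (fun x : ℝ => ((cdf μ x⁻¹ : ℝ) : ℂ)) (inv_pos.2 hγ)
    (by simpa using (hmel 0).1) (hint.congr (ae_of_all _ fun t => (hmel t).2.symm)) hcont
  rw [inv_inv, mellinInv] at h
  rw [← h, Complex.real_smul]
  push_cast
  rw [one_div]
  congr 1
  refine integral_congr_ae (ae_of_all _ fun t => ?_)
  simp only [(hmel t).2, smul_eq_mul]
  rw [Complex.inv_cpow _ _ (by rw [Complex.arg_ofReal_of_nonneg hγ.le]; exact Real.pi_pos.ne),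
    Complex.cpow_neg, inv_inv]

/-- If the moments of a positive diffuse law are given by a Mellin-Barnes integrand, then the
associated Meijer function is well defined and represents the cumulative distribution function. -/
theorem meijerG_of_hasNegMoment {μ : Measure ℝ} [IsProbabilityMeasure μ] (hμ : PosDiffuse μ)
    {m n p q : ℕ} {a : Fin p → ℂ} {b : Fin q → ℂ} {z C : ℂ} (hC : C ≠ 0) {γ : ℝ} (hγ : 0 < γ)
    {M : ℂ → ℂ} (hsep : ∃ σ, MeijerSeparates m n a b σ)
    (hpos : ∀ σ, MeijerSeparates m n a b σ → 0 < σ)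
    (hM : ∀ σ, MeijerSeparates m n a b σ → ∀ s : ℂ, s.re = σ → HasNegMoment μ s (M s))
    (hint : ∀ σ, MeijerSeparates m n a b σ →
      Integrable fun t : ℝ => M (σ + t * Complex.I) / (σ + t * Complex.I))
    (hG : ∀ s : ℂ, 0 < s.re → (γ : ℂ) ^ s * (M s / s) = C * meijerIntegrand m n a b z s) :
    MeijerGWellDefined m n a b z ∧ ((cdf μ γ : ℝ) : ℂ) = C * meijerG m n a b z := by
  have hline : ∀ σ, MeijerSeparates m n a b σ →
      Integrable (fun t : ℝ => meijerIntegrand m n a b z (σ + t * Complex.I)) ∧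
      ((cdf μ γ : ℝ) : ℂ) = C * meijerLineIntegral m n a b z σ := by
    intro σ hσ
    have he : ∀ t : ℝ, (γ : ℂ) ^ (σ + t * Complex.I : ℂ) *
        (M (σ + t * Complex.I) / (σ + t * Complex.I)) =
          C * meijerIntegrand m n a b z (σ + t * Complex.I) := fun t =>
      hG _ (by simpa using hpos σ hσ)
    constructor
    · have := integrable_cpow_mul (σ := σ) hγ (hint σ hσ)
      simp only [he] at this
      exact (integrable_const_mul_iff hC.isUnit _).1 this
    · rw [cdf_eq_integral_negMoment hμ (hpos σ hσ) (hM σ hσ) (hint σ hσ) hγ, meijerLineIntegral]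
      simp only [he, integral_const_mul]
      ring
  have hval : meijerG m n a b z = meijerLineIntegral m n a b z hsep.choose := dif_pos hsep
  have hcdf : ((cdf μ γ : ℝ) : ℂ) = C * meijerG m n a b z := by
    rw [hval]
    exact (hline _ hsep.choose_spec).2
  -- Two separating lines give the same CDF value up to the nonzero factor `C`, so their integrals
  -- agree.
  exact ⟨⟨hsep, fun σ hσ => ⟨(hline σ hσ).1,
    mul_left_cancel₀ hC ((hline σ hσ).2.symm.trans hcdf)⟩⟩, hcdf⟩

/-! ### The two shadowing models. -/

theorem ofReal_mul_cpow {x y : ℝ} (hx : 0 < x) (hy : 0 < y) (s : ℂ) :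
    ((x * y : ℝ) : ℂ) ^ s = (x : ℂ) ^ s * (y : ℂ) ^ s := by
  rw [Complex.ofReal_mul, Complex.mul_cpow_ofReal_nonneg hx.le hy.le]

theorem ofReal_inv_cpow {x : ℝ} (hx : 0 < x) (s : ℂ) :
    ((x⁻¹ : ℝ) : ℂ) ^ s = (x : ℂ) ^ (-s) := by
  rw [Complex.ofReal_inv,
    Complex.inv_cpow _ _ (by rw [Complex.arg_ofReal_of_nonneg hx.le]; exact Real.pi_pos.ne),
    Complex.cpow_neg]

/-- Accounts for the upper parameter `1` and the lower parameter `0` of both Meijer functions. -/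
theorem Gamma_mul_inv_Gamma_one_add {s : ℂ} (hs : 0 < s.re) :
    Complex.Gamma s * (Complex.Gamma (1 + s))⁻¹ = s⁻¹ := by
  have h0 : s ≠ 0 := fun h => by simp [h] at hs
  have h1 := Complex.Gamma_ne_zero_of_re_pos hs
  rw [add_comm, Complex.Gamma_add_one s h0]
  field_simp

theorem integrable_single_shadowing {m₁ m₂ α σ : ℝ} (hα : 0 < α) (hσ : 0 < σ) (h₁ : σ < m₁)
    (h₂ : σ < m₂) :
    Integrable fun t : ℝ => Complex.Gamma (m₁ - (σ + t * Complex.I)) *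
      (Complex.Gamma (m₂ - (σ + t * Complex.I)) *
      (Complex.Gamma (α + (σ + t * Complex.I)) * (σ + t * Complex.I : ℂ)⁻¹)) :=
  integrable_Gamma_mul (by fun_prop) (sub_pos.2 h₁) (fun t => by simp)
    (integrable_Gamma_mul (by fun_prop) (sub_pos.2 h₂) (fun t => by simp)
      (integrable_Gamma_mul_inv hα hσ))

theorem integrable_double_shadowing {m₁ m₂ α₁ α₂ σ : ℝ} (hα₁ : 0 < α₁) (hα₂ : 0 < α₂) (hσ : 0 < σ)
    (h₁ : σ < m₁) (h₂ : σ < m₂) :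
    Integrable fun t : ℝ => Complex.Gamma (α₂ + (σ + t * Complex.I)) *
      (Complex.Gamma (m₁ - (σ + t * Complex.I)) * (Complex.Gamma (m₂ - (σ + t * Complex.I)) *
      (Complex.Gamma (α₁ + (σ + t * Complex.I)) * (σ + t * Complex.I : ℂ)⁻¹))) :=
  integrable_Gamma_mul (by fun_prop) (add_pos hα₂ hσ) (fun t => by simp)
    (integrable_single_shadowing hα₁ hσ h₁ h₂)

theorem meijerSeparates_double {m₁ m₂ α₁ α₂ σ : ℝ} :
    MeijerSeparates 2 3 ![1 - (α₂ : ℂ), 1 - (α₁ : ℂ), 1] ![(m₁ : ℂ), (m₂ : ℂ), 0] σ ↔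
      (σ < m₁ ∧ σ < m₂) ∧ -α₂ < σ ∧ -α₁ < σ ∧ 0 < σ := by
  simp [MeijerSeparates, Fin.forall_fin_succ]

theorem meijerSeparates_single {m₁ m₂ α σ : ℝ} :
    MeijerSeparates 2 2 ![1 - (α : ℂ), 1] ![(m₁ : ℂ), (m₂ : ℂ), 0] σ ↔
      (σ < m₁ ∧ σ < m₂) ∧ -α < σ ∧ 0 < σ := by
  simp [MeijerSeparates, Fin.forall_fin_succ]

/-- The law of the signal-to-noise ratio under double shadowing. -/
theorem meijerG_double_shadowing {m₁ m₂ Ω α₁ α₂ g₁ g₂ : ℝ} (hm₁ : 0 < m₁) (hm₂ : 0 < m₂)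
    (hΩ : 0 < Ω) (hα₁ : 0 < α₁) (hα₂ : 0 < α₂) (hg₁ : 0 < g₁) (hg₂ : 0 < g₂)
    [IsProbabilityMeasure (nakagamiSqMeasure m₁ Ω)] [IsProbabilityMeasure (nakagamiSqMeasure m₂ Ω)]
    [IsProbabilityMeasure (invGammaMeasure α₁ g₁)] [IsProbabilityMeasure (invGammaMeasure α₂ g₂)]
    {γ : ℝ} (hγ : 0 < γ) :
    MeijerGWellDefined 2 3 ![1 - (α₂ : ℂ), 1 - (α₁ : ℂ), 1] ![(m₁ : ℂ), (m₂ : ℂ), 0]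
      ((m₁ * m₂ / (Ω ^ 2 * g₁ * g₂) * γ : ℝ) : ℂ) ∧
    ((cdf ((nakagamiSqMeasure m₁ Ω ∗ₘ invGammaMeasure α₁ g₁) ∗ₘ
        (nakagamiSqMeasure m₂ Ω ∗ₘ invGammaMeasure α₂ g₂)) γ : ℝ) : ℂ) =
      ((1 / (Real.Gamma m₁ * Real.Gamma m₂ * Real.Gamma α₁ * Real.Gamma α₂) : ℝ) : ℂ) *
        meijerG 2 3 ![1 - (α₂ : ℂ), 1 - (α₁ : ℂ), 1] ![(m₁ : ℂ), (m₂ : ℂ), 0]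
          ((m₁ * m₂ / (Ω ^ 2 * g₁ * g₂) * γ : ℝ) : ℂ) := by
  have hn₁ := posDiffuse_nakagamiSqMeasure m₁ Ω
  have hn₂ := posDiffuse_nakagamiSqMeasure m₂ Ω
  have hi₁ := posDiffuse_invGammaMeasure α₁ g₁
  have hi₂ := posDiffuse_invGammaMeasure α₂ g₂
  have hG₁ := Real.Gamma_pos_of_pos hm₁
  have hG₂ := Real.Gamma_pos_of_pos hm₂
  have hA₁ := Real.Gamma_pos_of_pos hα₁
  have hA₂ := Real.Gamma_pos_of_pos hα₂
  -- `c` is `γ̃`, factored in the order in which the four moments are multiplied.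
  set c : ℝ := m₁ / Ω * g₁⁻¹ * (m₂ / Ω * g₂⁻¹) with hc
  have hc0 : 0 < c := by positivity
  have hcs : ∀ s : ℂ, (c : ℂ) ^ s = ((m₁ / Ω : ℝ) : ℂ) ^ s * (g₁ : ℂ) ^ (-s) *
      (((m₂ / Ω : ℝ) : ℂ) ^ s * (g₂ : ℂ) ^ (-s)) := fun s => by
    rw [hc, ofReal_mul_cpow (by positivity) (by positivity),
      ofReal_mul_cpow (by positivity) (by positivity),
      ofReal_mul_cpow (by positivity) (by positivity), ofReal_inv_cpow hg₁, ofReal_inv_cpow hg₂]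
  have hz : m₁ * m₂ / (Ω ^ 2 * g₁ * g₂) * γ = c * γ := by
    rw [hc]
    field_simp
  set C : ℂ := ((1 / (Real.Gamma m₁ * Real.Gamma m₂ * Real.Gamma α₁ * Real.Gamma α₂) : ℝ) : ℂ)
    with hCdef
  have hC : C ≠ 0 := by
    rw [hCdef, Complex.ofReal_ne_zero]
    positivity
  refine meijerG_of_hasNegMoment ((hn₁.mconv hi₁).mconv (hn₂.mconv hi₂)) hC hγ
    (M := fun s => C * ((c : ℂ) ^ s * (Complex.Gamma (α₂ + s) * (Complex.Gamma (m₁ - s) *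
      (Complex.Gamma (m₂ - s) * Complex.Gamma (α₁ + s)))))) ?_ ?_ ?_ ?_ ?_
  -- The pole of `Γ(s)` at `0` forces `σ > 0`, and the shapes force `σ < min m₁ m₂`; the midpoint
  -- serves.
  · refine ⟨min m₁ m₂ / 2, meijerSeparates_double.2 ?_⟩
    have h0 : 0 < min m₁ m₂ := lt_min hm₁ hm₂
    have h1 := min_le_left m₁ m₂
    have h2 := min_le_right m₁ m₂
    refine ⟨⟨?_, ?_⟩, ?_, ?_, ?_⟩ <;> linarith
  · exact fun σ hσ => (meijerSeparates_double.1 hσ).2.2.2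
  · intro σ hσ s hs
    obtain ⟨⟨h1, h2⟩, h3, h4, -⟩ := meijerSeparates_double.1 hσ
    subst hs
    have := ((hasNegMoment_nakagamiSqMeasure hm₁ hΩ h1).mconv hn₁ hi₁
      (hasNegMoment_invGammaMeasure hα₁ hg₁ h4)).mconv (hn₁.mconv hi₁) (hn₂.mconv hi₂)
      ((hasNegMoment_nakagamiSqMeasure hm₂ hΩ h2).mconv hn₂ hi₂
        (hasNegMoment_invGammaMeasure hα₂ hg₂ h3))
    convert this using 1
    rw [hcs, hCdef]
    push_cast
    ring
  · intro σ hσ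
    obtain ⟨⟨h1, h2⟩, -, -, h0⟩ := meijerSeparates_double.1 hσ
    refine ((integrable_cpow_mul (σ := σ) hc0
      (integrable_double_shadowing hα₁ hα₂ h0 h1 h2)).const_mul C).congr (ae_of_all _ fun t => ?_)
    simp only [div_eq_mul_inv]
    ring
  · intro s hs
    have hp : meijerIntegrand 2 3 ![1 - (α₂ : ℂ), 1 - (α₁ : ℂ), 1] ![(m₁ : ℂ), (m₂ : ℂ), 0]
        ((c * γ : ℝ) : ℂ) s = Complex.Gamma (m₁ - s) * Complex.Gamma (m₂ - s) *
          (Complex.Gamma (1 + s))⁻¹ * (Complex.Gamma (α₂ + s) * Complex.Gamma (α₁ + s) *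
            Complex.Gamma s) * ((c * γ : ℝ) : ℂ) ^ s := by
      simp [meijerIntegrand, Fin.prod_univ_three]
    rw [hz, hp, ofReal_mul_cpow hc0 hγ, div_eq_mul_inv, ← Gamma_mul_inv_Gamma_one_add hs]
    ring

/-- The law of the signal-to-noise ratio under single shadowing. -/
theorem meijerG_single_shadowing {m₁ m₂ Ω α g : ℝ} (hm₁ : 0 < m₁) (hm₂ : 0 < m₂)
    (hΩ : 0 < Ω) (hα : 0 < α) (hg : 0 < g)
    [IsProbabilityMeasure (nakagamiSqMeasure m₁ Ω)] [IsProbabilityMeasure (nakagamiSqMeasure m₂ Ω)]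
    [IsProbabilityMeasure (invGammaMeasure α g)]
    {γ : ℝ} (hγ : 0 < γ) :
    MeijerGWellDefined 2 2 ![1 - (α : ℂ), 1] ![(m₁ : ℂ), (m₂ : ℂ), 0]
      ((m₁ * m₂ / (Ω ^ 2 * g) * γ : ℝ) : ℂ) ∧
    ((cdf ((nakagamiSqMeasure m₁ Ω ∗ₘ nakagamiSqMeasure m₂ Ω) ∗ₘ invGammaMeasure α g) γ : ℝ) : ℂ) =
      ((1 / (Real.Gamma m₁ * Real.Gamma m₂ * Real.Gamma α) : ℝ) : ℂ) *
        meijerG 2 2 ![1 - (α : ℂ), 1] ![(m₁ : ℂ), (m₂ : ℂ), 0]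
          ((m₁ * m₂ / (Ω ^ 2 * g) * γ : ℝ) : ℂ) := by
  have hn₁ := posDiffuse_nakagamiSqMeasure m₁ Ω
  have hn₂ := posDiffuse_nakagamiSqMeasure m₂ Ω
  have hi := posDiffuse_invGammaMeasure α g
  have hG₁ := Real.Gamma_pos_of_pos hm₁
  have hG₂ := Real.Gamma_pos_of_pos hm₂
  have hA := Real.Gamma_pos_of_pos hα
  set c : ℝ := m₁ / Ω * (m₂ / Ω) * g⁻¹ with hc
  have hc0 : 0 < c := by positivity
  have hcs : ∀ s : ℂ, (c : ℂ) ^ s = ((m₁ / Ω : ℝ) : ℂ) ^ s * ((m₂ / Ω : ℝ) : ℂ) ^ s *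
      (g : ℂ) ^ (-s) := fun s => by
    rw [hc, ofReal_mul_cpow (by positivity) (by positivity),
      ofReal_mul_cpow (by positivity) (by positivity), ofReal_inv_cpow hg]
  have hz : m₁ * m₂ / (Ω ^ 2 * g) * γ = c * γ := by
    rw [hc]
    field_simp
  set C : ℂ := ((1 / (Real.Gamma m₁ * Real.Gamma m₂ * Real.Gamma α) : ℝ) : ℂ)
    with hCdef
  have hC : C ≠ 0 := by
    rw [hCdef, Complex.ofReal_ne_zero]
    positivity
  refine meijerG_of_hasNegMoment ((hn₁.mconv hn₂).mconv hi) hC hγ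
    (M := fun s => C * ((c : ℂ) ^ s * (Complex.Gamma (m₁ - s) *
      (Complex.Gamma (m₂ - s) * Complex.Gamma (α + s))))) ?_ ?_ ?_ ?_ ?_
  · refine ⟨min m₁ m₂ / 2, meijerSeparates_single.2 ?_⟩
    have h0 : 0 < min m₁ m₂ := lt_min hm₁ hm₂
    have h1 := min_le_left m₁ m₂
    have h2 := min_le_right m₁ m₂
    refine ⟨⟨?_, ?_⟩, ?_, ?_⟩ <;> linarith
  · exact fun σ hσ => (meijerSeparates_single.1 hσ).2.2
  · intro σ hσ s hs
    obtain ⟨⟨h1, h2⟩, h3, -⟩ := meijerSeparates_single.1 hσ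
    subst hs
    have := ((hasNegMoment_nakagamiSqMeasure hm₁ hΩ h1).mconv hn₁ hn₂
      (hasNegMoment_nakagamiSqMeasure hm₂ hΩ h2)).mconv (hn₁.mconv hn₂) hi
      (hasNegMoment_invGammaMeasure hα hg h3)
    convert this using 1
    rw [hcs, hCdef]
    push_cast
    ring
  · intro σ hσ
    obtain ⟨⟨h1, h2⟩, -, h0⟩ := meijerSeparates_single.1 hσ
    refine ((integrable_cpow_mul (σ := σ) hc0
      (integrable_single_shadowing hα h0 h1 h2)).const_mul C).congr (ae_of_all _ fun t => ?_)
    simp only [div_eq_mul_inv]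
    ring
  · intro s hs
    have hp : meijerIntegrand 2 2 ![1 - (α : ℂ), 1] ![(m₁ : ℂ), (m₂ : ℂ), 0]
        ((c * γ : ℝ) : ℂ) s = Complex.Gamma (m₁ - s) * Complex.Gamma (m₂ - s) *
          (Complex.Gamma (1 + s))⁻¹ * (Complex.Gamma (α + s) *
            Complex.Gamma s) * ((c * γ : ℝ) : ℂ) ^ s := by
      simp [meijerIntegrand, Fin.prod_univ_three, Fin.prod_univ_two]
    rw [hz, hp, ofReal_mul_cpow hc0 hγ, div_eq_mul_inv, ← Gamma_mul_inv_Gamma_one_add hs]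
    ring

/-! ### From random variables to their laws. -/

theorem outageProbability_eq_cdf {S : Type*} [MeasurableSpace S] {P : Measure S}
    [IsProbabilityMeasure P] {X : S → ℝ} (hX : AEMeasurable X P) (γ : ℝ) :
    outageProbability P X γ = cdf (P.map X) γ := by
  have := isProbabilityMeasure_map hX
  rw [cdf_eq_real, map_measureReal_apply_of_aemeasurable hX measurableSet_Iic]
  rfl

end

end ShadowedScattering

open MeasureTheory ProbabilityTheory ShadowedScattering in
theorem mainTheorem4 {S : Type*} [MeasurableSpace S] (P : Measure S) [IsProbabilityMeasure P]
    (m₁ m₂ Ω : ℝ) (hm₁ : 0 < m₁) (hm₂ : 0 < m₂) (hΩ : 0 < Ω) :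
    -- double shadowing
    (∀ (α₁ α₂ g₁ g₂ : ℝ) (N₁ N₂ I₁ I₂ : S → ℝ),
      1 < α₁ → 1 < α₂ → 0 < g₁ → 0 < g₂ →
      HasLaw (fun ω => N₁ ω ^ 2) (nakagamiSqMeasure m₁ Ω) P →
      HasLaw (fun ω => N₂ ω ^ 2) (nakagamiSqMeasure m₂ Ω) P →
      HasLaw I₁ (invGammaMeasure α₁ g₁) P →
      HasLaw I₂ (invGammaMeasure α₂ g₂) P →
      IndepFun (fun ω => N₁ ω ^ 2) I₁ P →
      IndepFun (fun ω => N₂ ω ^ 2) I₂ P →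
      IndepFun (fun ω => N₁ ω ^ 2 * I₁ ω) (fun ω => N₂ ω ^ 2 * I₂ ω) P →
      ∀ γ : ℝ, 0 < γ →
        outageProbability P (fun ω => (N₁ ω ^ 2 * I₁ ω) * (N₂ ω ^ 2 * I₂ ω)) γ =
          cdf (P.map fun ω => (N₁ ω ^ 2 * I₁ ω) * (N₂ ω ^ 2 * I₂ ω)) γ ∧
        MeijerGWellDefined 2 3 ![1 - (α₂ : ℂ), 1 - (α₁ : ℂ), 1] ![(m₁ : ℂ), (m₂ : ℂ), 0]
          ((m₁ * m₂ / (Ω ^ 2 * g₁ * g₂) * γ : ℝ) : ℂ) ∧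
        ((cdf (P.map fun ω => (N₁ ω ^ 2 * I₁ ω) * (N₂ ω ^ 2 * I₂ ω)) γ : ℝ) : ℂ) =
          ((1 / (Real.Gamma m₁ * Real.Gamma m₂ * Real.Gamma α₁ * Real.Gamma α₂) : ℝ) : ℂ) *
            meijerG 2 3 ![1 - (α₂ : ℂ), 1 - (α₁ : ℂ), 1] ![(m₁ : ℂ), (m₂ : ℂ), 0]
              ((m₁ * m₂ / (Ω ^ 2 * g₁ * g₂) * γ : ℝ) : ℂ)) ∧
    -- single shadowing
    (∀ (α g : ℝ) (N₁ N₂ I : S → ℝ),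
      1 < α → 0 < g →
      HasLaw (fun ω => N₁ ω ^ 2) (nakagamiSqMeasure m₁ Ω) P →
      HasLaw (fun ω => N₂ ω ^ 2) (nakagamiSqMeasure m₂ Ω) P →
      HasLaw I (invGammaMeasure α g) P →
      IndepFun (fun ω => N₁ ω ^ 2) (fun ω => N₂ ω ^ 2) P →
      IndepFun (fun ω => (N₁ ω * N₂ ω) ^ 2) I P →
      ∀ γ : ℝ, 0 < γ →
        outageProbability P (fun ω => (N₁ ω * N₂ ω) ^ 2 * I ω) γ =
          cdf (P.map fun ω => (N₁ ω * N₂ ω) ^ 2 * I ω) γ ∧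
        MeijerGWellDefined 2 2 ![1 - (α : ℂ), 1] ![(m₁ : ℂ), (m₂ : ℂ), 0]
          ((m₁ * m₂ / (Ω ^ 2 * g) * γ : ℝ) : ℂ) ∧
        ((cdf (P.map fun ω => (N₁ ω * N₂ ω) ^ 2 * I ω) γ : ℝ) : ℂ) =
          ((1 / (Real.Gamma m₁ * Real.Gamma m₂ * Real.Gamma α) : ℝ) : ℂ) *
            meijerG 2 2 ![1 - (α : ℂ), 1] ![(m₁ : ℂ), (m₂ : ℂ), 0]
              ((m₁ * m₂ / (Ω ^ 2 * g) * γ : ℝ) : ℂ)) := by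
  refine ⟨?_, ?_⟩
  · intro α₁ α₂ g₁ g₂ N₁ N₂ I₁ I₂ hα₁ hα₂ hg₁ hg₂ hN₁ hN₂ hI₁ hI₂ h₁ h₂ h γ hγ
    -- Each density has total mass one because its measure is the law of a variable under `P`.
    have := hN₁.isProbabilityMeasure_iff.1 ‹_›
    have := hN₂.isProbabilityMeasure_iff.1 ‹_›
    have := hI₁.isProbabilityMeasure_iff.1 ‹_›
    have := hI₂.isProbabilityMeasure_iff.1 ‹_›
    have hX := h.hasLaw_fun_mul (h₁.hasLaw_fun_mul hN₁ hI₁) (h₂.hasLaw_fun_mul hN₂ hI₂)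
    refine ⟨outageProbability_eq_cdf hX.aemeasurable γ, ?_⟩
    rw [hX.map_eq]
    exact meijerG_double_shadowing hm₁ hm₂ hΩ (by linarith) (by linarith) hg₁ hg₂ hγ
  · intro α g N₁ N₂ I hα hg hN₁ hN₂ hI h₁ h γ hγ
    have := hN₁.isProbabilityMeasure_iff.1 ‹_›
    have := hN₂.isProbabilityMeasure_iff.1 ‹_›
    have := hI.isProbabilityMeasure_iff.1 ‹_›
    have hN := h₁.hasLaw_fun_mul hN₁ hN₂
    simp only [← mul_pow] at hN
    have hX := h.hasLaw_fun_mul hN hI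
    refine ⟨outageProbability_eq_cdf hX.aemeasurable γ, ?_⟩
    rw [hX.map_eq]
    exact meijerG_single_shadowing hm₁ hm₂ hΩ (by linarith) hg hγ
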